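/- **Setting.** Let $\mathcal A$ be a unital C*-algebra with $1\neq 0$ and center $\mathcal Z$. For unital *-endomorphisms $\alpha,\beta$ of $\mathcal A$ put $(\alpha,\beta)=\{X\in\mathcal A : X\alpha(A)=\beta(A)X\ \text{for all } A\in\mathcal A\}$. Write $\alpha\beta=\alpha\circ\beta$ and $\iota=\mathrm{id}$. An isometry is a $V\in\mathcal A$ with $V^*V=1$. Call $\alpha,\beta$ *unitarily equivalent* if $(\alpha,\beta)$ contains a unitary, and *disjoint* if $(\alpha,\beta)=\{0\}$. Let $\mathcal T$ be a category whose objects form a set $\mathrm{Ob}\,\mathcal T$ of unital *-endomorphisms of $\mathcal A$ that contains $\iota$ and is closed under composition, with the spaces $(\alpha,\beta)$ as arrows. Assume the following. * (Direct sums) For all objects $\alpha,\beta$ there are isometries $V,W$ with $V^*W=0$, $VV^*+WW^*=1$ and $V\alpha(\cdot)V^*+W\beta(\cdot)W^*\in\mathrm{Ob}\,\mathcal T$. * (Subobjects) If $\alpha$ is an object and $\beta$ is a unital *-endomorphism such that $(\beta,\alpha)$ contains an isometry, then $\beta$ is unitarily equivalent to an object. * (Complements) If $\alpha,\beta$ are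 objects and $(\beta,\alpha)$ contains an isometry $V_0$ with $V_0V_0^*\ne1$, then there are an object $\beta'$ and isometries $V\in(\beta,\alpha)$, $W\in(\beta',\alpha)$ with $VV^*+WW^*=1$. Let $\mathcal T_{\mathbb C}$ be a subcategory of $\mathcal T$ with the same objects, whose arrow spaces are norm-closed linear subspaces $(\alpha,\beta)_{\mathbb C}\subseteq(\alpha,\beta)$, with $1\in(\alpha,\alpha)_{\mathbb C}$, such that for all objects: 1. $(\beta,\gamma)_{\mathbb C}(\alpha,\beta)_{\mathbb C}\subseteq(\alpha,\gamma)_{\mathbb C}$, $\ \alpha((\beta,\gamma)_{\mathbb C})\subseteq(\alpha\beta,\alpha\gamma)_{\mathbb C}$, $\ (\alpha,\beta)_{\mathbb C}\subseteq(\alpha\gamma,\beta\gamma)_{\mathbb C}$, $\ (\alpha,\beta)_{\mathbb C}^*\subseteq(\beta,\alpha)_{\mathbb C}$, $\ (\iota,\iota)_{\mathbb C}=\mathbb C1$. 2. If $F_1,\dots,F_n\in(\alpha,\beta)_{\mathbb C}$ are linearly independent over $\mathbb C$, $Z_j\in\mathcal Z$ and $\sum_jF_j\alpha(Z_j)=0$,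 then $\alpha(Z_j)=0$ for all $j$. Moreover $(\alpha,\beta)$ is the linear span of $(\alpha,\beta)_{\mathbb C}\,\alpha(\mathcal Z)$. 3. For all objects $\alpha,\beta$ there are an object $\gamma$ and isometries $V\in(\alpha,\gamma)_{\mathbb C}$, $W\in(\beta,\gamma)_{\mathbb C}$ with $V^*W=0$ and $VV^*+WW^*=1$. Every nonzero projection $E\in(\alpha,\alpha)_{\mathbb C}$ is of the form $VV^*$ with an isometry $V\in(\beta,\alpha)_{\mathbb C}$ for some object $\beta$. For every isometry $V\in(\beta,\alpha)_{\mathbb C}$ with $VV^*\ne 1$ there are an object $\beta'$ and an isometry $W\in(\beta',\alpha)_{\mathbb C}$ with $VV^*+WW^*=1$. 4. (Permutation structure) There are given unitaries $\epsilon(\alpha,\beta)\in(\alpha\beta,\beta\alpha)_{\mathbb C}$ with $\epsilon(\alpha,\beta)\epsilon(\beta,\alpha)=1$, $\epsilon(\iota,\alpha)=\epsilon(\alpha,\iota)=1$, $\epsilon(\alpha\beta,\gamma)=\epsilon(\alpha,\gamma)\alpha(\epsilon(\beta,\gamma))$, and $\epsilon(\alpha',\beta')\,X\alpha(Y)=Y\beta(X)\,\epsilon(\alpha,\beta)$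 for $X\in(\alpha,\alpha')_{\mathbb C}$, $Y\in(\beta,\beta')_{\mathbb C}$. 5. (Conjugation structure) For each object $\alpha$ there are given an object $\overline\alpha$ and arrows $R_\alpha\in(\iota,\overline\alpha\alpha)_{\mathbb C}$, $S_\alpha\in(\iota,\alpha\overline\alpha)_{\mathbb C}$ with $S_\alpha^*\alpha(R_\alpha)=1$, $R_\alpha^*\overline\alpha(S_\alpha)=1$ and $S_\alpha=\epsilon(\overline\alpha,\alpha)R_\alpha$. The dimension $d(\alpha)\in\mathbb C$ of an object is defined by $d(\alpha)1=R_\alpha^*R_\alpha$ (which lies in $(\iota,\iota)_{\mathbb C}=\mathbb C1$), and $m(\rho,\alpha):=\dim_{\mathbb C}(\rho,\alpha)_{\mathbb C}$. An object $\rho$ is *irreducible* if $(\rho,\rho)=\mathcal Z$. A *complete system* $\mathrm{Irr}_0\mathcal T$ is a set of mutually disjoint irreducible objects such that every irreducible object is unitarily equivalent to a member of it. **Proposition 3.5.** (I) $d(\alpha)$ is a positive integer for every object $\alpha$. (II) $m(\rho,\alpha)<\infty$ for every irreducible $\rho$ and every object $\alpha$, and complete systems exist. For every complete system $\mathrm{Irr}_0\mathcal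 T$ and every object $\alpha$ there are finitely many distinct $\rho_1,\dots,\rho_r\in\mathrm{Irr}_0\mathcal T$ with $m(\rho_j,\alpha)\ge1$ such that $\alpha$ is the direct sum of the $\rho_j$, each taken $m(\rho_j,\alpha)$ times. That is, there are isometries $W_{jl}\in(\rho_j,\alpha)_{\mathbb C}$ $(1\le j\le r,\ 1\le l\le m(\rho_j,\alpha))$ with $W_{jl}^*W_{j'l'}=0$ for $(j,l)\ne(j',l')$, $\sum_{j,l}W_{jl}W_{jl}^*=1$ and $\alpha(\cdot)=\sum_{j,l}W_{jl}\,\rho_j(\cdot)\,W_{jl}^*$. Moreover $d(\alpha)=\sum_{j=1}^r m(\rho_j,\alpha)\,d(\rho_j)$. (III) Two objects $\alpha,\beta$ are unitarily equivalent if and only if $m(\rho,\alpha)=m(\rho,\beta)$ for all irreducible $\rho$; equivalently, for all $\rho$ in any given complete system. -/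

import Mathlib

/-- Unital *-endomorphisms of the unital C*-algebra `A`. The composite `αβ` is `α.comp β`. -/
abbrev EndStar (A : Type*) [CStarAlgebra A] := A →⋆ₐ[ℂ] A

/-- The identical endomorphism `ι`. -/
abbrev idEnd (A : Type*) [CStarAlgebra A] : EndStar A := StarAlgHom.id ℂ A

/-- The intertwiner space `(α, β) = {X ∈ A | X α(a) = β(a) X for all a ∈ A}`. -/
def intertwiners {A : Type*} [CStarAlgebra A] (α β : EndStar A) : Submodule ℂ A where
  carrier := {X | ∀ a : A, X * α a = β a * X}
  zero_mem' := by intro a; simp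
  add_mem' := by
    intro X Y hX hY a
    rw [add_mul, mul_add, hX a, hY a]
  smul_mem' := by
    intro c X hX a
    rw [smul_mul_assoc, mul_smul_comm, hX a]

/-- `V` is an isometry of the algebra: `V* V = 1`. -/
def IsIsom {A : Type*} [CStarAlgebra A] (V : A) : Prop := star V * V = 1

/-- `α` and `β` are unitarily equivalent: there is a unitary in `(α, β)`. -/
def UnitarilyEquiv {A : Type*} [CStarAlgebra A] (α β : EndStar A) : Prop :=
  ∃ U ∈ intertwiners α β, U ∈ unitary A

/-- `α` and `β` are disjoint: `(α, β) = {0}`. -/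
def DisjointEnd {A : Type*} [CStarAlgebra A] (α β : EndStar A) : Prop :=
  intertwiners α β = ⊥

/-- A tensor C*-category of unital endomorphisms of `A` (arrows `intertwiners α β`, tensor
product on objects given by composition), closed under direct sums, subobjects and
complementary subobjects. -/
structure EndCategory (A : Type*) [CStarAlgebra A] where
  /-- the objects -/
  Ob : Set (EndStar A)
  id_mem : idEnd A ∈ Ob
  comp_mem : ∀ α ∈ Ob, ∀ β ∈ Ob, α.comp β ∈ Ob
  /-- direct sums `γ = V α(·) V* + W β(·) W*` -/
  directSum : ∀ α ∈ Ob, ∀ β ∈ Ob, ∃ V W : A, IsIsom V ∧ IsIsom W ∧ star V * W = 0 ∧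
    V * star V + W * star W = 1 ∧
    ∃ γ ∈ Ob, ∀ a : A, γ a = V * α a * star V + W * β a * star W
  /-- subobjects: an endomorphism `β` with an isometry in `(β, α)` is an object, up to
  unitary equivalence (in particular this holds if `β` itself is an object) -/
  subobject : ∀ α ∈ Ob, ∀ β : EndStar A, (∃ V ∈ intertwiners β α, IsIsom V) →
    ∃ β' ∈ Ob, UnitarilyEquiv β' β
  /-- complementary subobjects: a proper subobject `β < α` has a complement `β' < α` with
  `α = β ⊕ β'` -/
  complement : ∀ α ∈ Ob, ∀ β ∈ Ob,
    (∃ V ∈ intertwiners β α, IsIsom V ∧ V * star V ≠ 1) →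
    ∃ β' ∈ Ob, ∃ V ∈ intertwiners β α, ∃ W ∈ intertwiners β' α,
      IsIsom V ∧ IsIsom W ∧ V * star V + W * star W = 1

namespace EndCategory

/-- The irreducible objects: `(ρ, ρ)` is the center of `A`. -/
def Irr {A : Type*} [CStarAlgebra A] (T : EndCategory A) : Set (EndStar A) :=
  {ρ | ρ ∈ T.Ob ∧ (intertwiners ρ ρ : Set A) = Set.center A}

/-- `I` is a complete system of irreducible and mutually disjoint objects. -/
structure IsCompleteIrr {A : Type*} [CStarAlgebra A] (T : EndCategory A)
    (I : Set (EndStar A)) : Prop where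
  irr : I ⊆ T.Irr
  disjoint : ∀ ρ ∈ I, ∀ σ ∈ I, ρ ≠ σ → DisjointEnd ρ σ
  complete : ∀ σ ∈ T.Irr, ∃ ρ ∈ I, UnitarilyEquiv σ ρ

end EndCategory

/-- A C*-subcategory `T_ℂ` of `T` with the same objects and with arrow spaces
`hom α β = (α, β)_ℂ`, together with a permutation structure `ε` and a conjugation structure
`conj, R, S`. Only the values on objects of `T` matter. -/
structure SymmetricSubcategory {A : Type*} [CStarAlgebra A] (T : EndCategory A) where
  /-- the arrow spaces `(α, β)_ℂ` -/
  hom : EndStar A → EndStar A → Submodule ℂ A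
  hom_le : ∀ α ∈ T.Ob, ∀ β ∈ T.Ob, hom α β ≤ intertwiners α β
  isClosed_hom : ∀ α ∈ T.Ob, ∀ β ∈ T.Ob, IsClosed (hom α β : Set A)
  one_mem : ∀ α ∈ T.Ob, (1 : A) ∈ hom α α
  mul_mem : ∀ α ∈ T.Ob, ∀ β ∈ T.Ob, ∀ γ ∈ T.Ob,
    ∀ X ∈ hom β γ, ∀ Y ∈ hom α β, X * Y ∈ hom α γ
  map_mem : ∀ α ∈ T.Ob, ∀ β ∈ T.Ob, ∀ γ ∈ T.Ob,
    ∀ X ∈ hom β γ, α X ∈ hom (α.comp β) (α.comp γ)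
  whisker_mem : ∀ α ∈ T.Ob, ∀ β ∈ T.Ob, ∀ γ ∈ T.Ob,
    ∀ X ∈ hom α β, X ∈ hom (α.comp γ) (β.comp γ)
  star_mem : ∀ α ∈ T.Ob, ∀ β ∈ T.Ob, ∀ X ∈ hom α β, star X ∈ hom β α
  /-- `(ι, ι)_ℂ = ℂ 1` -/
  hom_id : hom (idEnd A) (idEnd A) = Submodule.span ℂ {(1 : A)}
  /-- linear independence over `ℂ` implies linear independence modulo `α(Z)` -/
  indep : ∀ α ∈ T.Ob, ∀ β ∈ T.Ob, ∀ (n : ℕ) (F Z : Fin n → A),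
    (∀ j, F j ∈ hom α β) → LinearIndependent ℂ F → (∀ j, Z j ∈ Set.center A) →
    ∑ j, F j * α (Z j) = 0 → ∀ j, α (Z j) = 0
  /-- `(α, β)` is generated by `(α, β)_ℂ` as a right `α(Z)`-module; as `(α, β)` is also a left
  `β(Z)`-module, it is then generated as a bimodule, too -/
  generates : ∀ α ∈ T.Ob, ∀ β ∈ T.Ob, intertwiners α β =
    Submodule.span ℂ {X | ∃ F ∈ hom α β, ∃ Z ∈ Set.center A, X = F * α Z}
  /-- direct sums in `T_ℂ` -/
  directSum : ∀ α ∈ T.Ob, ∀ β ∈ T.Ob, ∃ γ ∈ T.Ob, ∃ V ∈ hom α γ, ∃ W ∈ hom β γ,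
    IsIsom V ∧ IsIsom W ∧ star V * W = 0 ∧ V * star V + W * star W = 1
  /-- subobjects in `T_ℂ`: every nonzero projection in `(α, α)_ℂ` is the range of an isometry
  of `T_ℂ` -/
  subobject : ∀ α ∈ T.Ob, ∀ E ∈ hom α α, IsStarProjection E → E ≠ 0 →
    ∃ β ∈ T.Ob, ∃ V ∈ hom β α, IsIsom V ∧ V * star V = E
  /-- complementary subobjects in `T_ℂ` -/
  complement : ∀ α ∈ T.Ob, ∀ β ∈ T.Ob, ∀ V ∈ hom β α, IsIsom V → V * star V ≠ 1 →
    ∃ β' ∈ T.Ob, ∃ W ∈ hom β' α, IsIsom W ∧ V * star V + W * star W = 1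
  /-- the permutation structure -/
  ε : EndStar A → EndStar A → A
  ε_mem : ∀ α ∈ T.Ob, ∀ β ∈ T.Ob, ε α β ∈ hom (α.comp β) (β.comp α)
  ε_unitary : ∀ α ∈ T.Ob, ∀ β ∈ T.Ob, ε α β ∈ unitary A
  ε_symm : ∀ α ∈ T.Ob, ∀ β ∈ T.Ob, ε α β * ε β α = 1
  ε_id_left : ∀ α ∈ T.Ob, ε (idEnd A) α = 1
  ε_id_right : ∀ α ∈ T.Ob, ε α (idEnd A) = 1
  ε_comp : ∀ α ∈ T.Ob, ∀ β ∈ T.Ob, ∀ γ ∈ T.Ob,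
    ε (α.comp β) γ = ε α γ * α (ε β γ)
  /-- `ε(α', β') (X × Y) = (Y × X) ε(α, β)`, where `X × Y = X α(Y)` for `X ∈ (α, α')_ℂ` and
  `Y ∈ (β, β')_ℂ` -/
  ε_natural : ∀ α ∈ T.Ob, ∀ α' ∈ T.Ob, ∀ β ∈ T.Ob, ∀ β' ∈ T.Ob,
    ∀ X ∈ hom α α', ∀ Y ∈ hom β β',
      ε α' β' * (X * α Y) = (Y * β X) * ε α β
  /-- the conjugate object -/
  conj : EndStar A → EndStar A
  /-- the arrow `R_α ∈ (ι, conj α ∘ α)_ℂ` -/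
  R : EndStar A → A
  /-- the arrow `S_α ∈ (ι, α ∘ conj α)_ℂ` -/
  S : EndStar A → A
  conj_mem : ∀ α ∈ T.Ob, conj α ∈ T.Ob
  R_mem : ∀ α ∈ T.Ob, R α ∈ hom (idEnd A) ((conj α).comp α)
  S_mem : ∀ α ∈ T.Ob, S α ∈ hom (idEnd A) (α.comp (conj α))
  conj_eq_left : ∀ α ∈ T.Ob, star (S α) * α (R α) = 1
  conj_eq_right : ∀ α ∈ T.Ob, star (R α) * (conj α) (S α) = 1
  S_eq : ∀ α ∈ T.Ob, S α = ε (conj α) α * R α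

namespace SymmetricSubcategory

/-- The dimension `d(α)`: the scalar with `d(α) 1 = R_α* R_α`, see `dim_spec`. -/
noncomputable def dim {A : Type*} [CStarAlgebra A] {T : EndCategory A}
    (C : SymmetricSubcategory T) (α : EndStar A) : ℂ :=
  Classical.epsilon fun d : ℂ => d • (1 : A) = star (C.R α) * C.R α

theorem dim_spec {A : Type*} [CStarAlgebra A] {T : EndCategory A}
    (C : SymmetricSubcategory T) (α : EndStar A) (hα : α ∈ T.Ob) :
    C.dim α • (1 : A) = star (C.R α) * C.R α := by
  have hc := T.comp_mem _ (C.conj_mem α hα) _ hα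
  have h : star (C.R α) * C.R α ∈ C.hom (idEnd A) (idEnd A) :=
    C.mul_mem _ T.id_mem _ hc _ T.id_mem _
      (C.star_mem _ T.id_mem _ hc _ (C.R_mem α hα)) _ (C.R_mem α hα)
  rw [C.hom_id, Submodule.mem_span_singleton] at h
  exact Classical.epsilon_spec h

/-- `m(ρ, α) = dim (ρ, α)_ℂ`. -/
noncomputable def mult {A : Type*} [CStarAlgebra A] {T : EndCategory A}
    (C : SymmetricSubcategory T) (ρ α : EndStar A) : ℕ :=
  Module.finrank ℂ (C.hom ρ α)

end SymmetricSubcategory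

/-! ### Positivity of scalars and antisymmetrizers -/

section StarAlgebra

variable {A : Type*} [CStarAlgebra A]

/-! Conjugates turn arrows into partial traces `Φ(X) = R* ᾱ(X) R`, and the permutation `s = ε(α, α)`
has partial trace `1`. Permutation symmetry makes dimensions integral: the antisymmetrizers `a n`
are projections (`antisymmetrizer_spec`) with `(n + 1) Φ(a (n + 1)) = (d - n) a n`. If `d` were not
a natural number, no `a n` would vanish, and the first `n > d` would make a positive element a
negative multiple of a nonzero positive one.

The trace property `star_S_mul_mul_S` gives `S* (W W*) S = d(β) 1` for an isometry `W` of `T_ℂ` from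
`β` to `α`. So `d` is additive on direct sums, and since it is positive it bounds the number of
orthogonal copies of `ρ` in `α`. Frobenius reciprocity `X ↦ X S` embeds `(α, α)_ℂ` into `(ι, α
ᾱ)_ℂ`, where `X* Y` is scalar. Hence `(α, α)_ℂ` is a finite-dimensional C*-algebra and contains a
nontrivial projection unless it is `ℂ 1`. Splitting along such projections strictly lowers `d`, so
it ends with objects whose `T_ℂ`-endomorphisms are scalar; these are exactly the irreducible ones
(`irr_of_scalar`, `scalar_of_irr`).

For the classification, equal multiplicities let one pair orthonormal bases into a unitary `∑ V W*`.
Conversely, a unitary between `α` and `β` need not lie in `T_ℂ`, but its matrix in orthonormal bases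
has entries in the center. An invertible matrix over a nontrivial commutative ring is square, so the
multiplicities agree. -/

theorem nonneg_of_star_mul_self_eq_smul {c : ℝ} {y z : A} (hz : z ≠ 0)
    (h : star y * y = (c : ℂ) • (star z * z)) : 0 ≤ c := by
  let _ := CStarAlgebra.spectralOrder A
  have _ := CStarAlgebra.spectralOrderedRing A
  by_contra! hc
  have h1 : (0 : A) ≤ star y * y := star_mul_self_nonneg y
  -- For `c < 0` the vector `√(-c) z` has square `-y* y`, so `y* y` is both nonnegative and
  -- nonpositive.
  have h2 : (0 : A) ≤ star (((Real.sqrt (-c) : ℝ) : ℂ) • z) * (((Real.sqrt (-c) : ℝ) : ℂ) • z) :=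
    star_mul_self_nonneg _
  have h3 : star (((Real.sqrt (-c) : ℝ) : ℂ) • z) * (((Real.sqrt (-c) : ℝ) : ℂ) • z)
      = -(star y * y) := by
    rw [h, star_smul, smul_mul_smul_comm, ← neg_smul, Complex.star_def, Complex.conj_ofReal,
      ← Complex.ofReal_mul, Real.mul_self_sqrt (by linarith), Complex.ofReal_neg]
  have h4 : star y * y = 0 := le_antisymm (by rw [h3] at h2; exact neg_nonneg.mp h2) h1
  rw [h4] at h
  have h5 := (smul_eq_zero.mp h.symm).resolve_left (by exact_mod_cast hc.ne)
  exact hz (CStarRing.star_mul_self_eq_zero_iff z |>.mp h5)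

/-- A scalar of the form `x* x` is a nonnegative real number. -/
theorem exists_nonneg_of_star_mul_self_eq_smul_one [Nontrivial A] {c : ℂ} {x : A}
    (h : star x * x = c • (1 : A)) : ∃ r : ℝ, 0 ≤ r ∧ c = r := by
  have h1 : star (c • (1 : A)) = c • (1 : A) := by rw [← h]; simp
  rw [star_smul, star_one] at h1
  have h2 : star c = c := by
    have := sub_eq_zero.mpr h1
    rw [← sub_smul] at this
    exact sub_eq_zero.mp ((smul_eq_zero.mp this).resolve_right one_ne_zero)
  obtain ⟨r, hr⟩ := Complex.conj_eq_iff_real.mp h2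
  refine ⟨r, nonneg_of_star_mul_self_eq_smul (y := x) (z := 1) one_ne_zero ?_, hr⟩
  rw [h, hr]; simp

/-- The antisymmetrizers built from an endomorphism `α` and a flip `s` in `(α², α²)`. -/
noncomputable def antisymmetrizer (α : EndStar A) (s : A) : ℕ → A
  | 0 => 1
  | n + 1 => ((n : ℂ) + 1)⁻¹ • (α (antisymmetrizer α s n) -
      (n : ℂ) • (α (antisymmetrizer α s n) * s * α (antisymmetrizer α s n)))

/-- In the application `N = n + 2`, `r = α²(a (n + 1))`, `p = α(a (n + 2))`, `t = α(s)` and `a = a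
(n + 3)`. Expand the first `p` in `p s p` and in `s p s p` by the recursion and move `s` through
`r`. The braid relation and `t p = -p` give `s t s p = -t s p`, so `s` reverses the sign of `p - N p
s p`. -/
theorem antisymmetrizer_step {N : ℂ} {r p s t a : A} (hN1 : N + 1 ≠ 0)
    (hp : N • p = r - (N - 1) • (r * t * r)) (hrp : r * p = p)
    (htp : t * p = -p) (hrs : r * s = s * r) (hss : s * s = 1)
    (hbraid : s * t * s = t * s * t) (ha : (N + 1) • a = p - N • (p * s * p)) :
    s * a = -a := by
  have hrsp : r * (s * p) = s * p := by rw [← mul_assoc, hrs, mul_assoc, hrp]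
  have hssp : s * (s * p) = p := by rw [← mul_assoc, hss, one_mul]
  have h3 : s * (t * (s * p)) = -(t * (s * p)) := by
    rw [← mul_assoc, ← mul_assoc, hbraid, mul_assoc, htp, mul_neg, mul_assoc]
  have hsr : ∀ x, s * (r * x) = r * (s * x) := fun x => by
    rw [← mul_assoc, ← hrs, mul_assoc]
  have hF : N • (s * (p * (s * p))) = p + (N - 1) • (r * (t * (s * p))) := by
    rw [← mul_smul_comm, ← smul_mul_assoc, hp, sub_mul, hrsp, mul_sub, hssp, smul_mul_assoc,
      mul_smul_comm, mul_assoc, mul_assoc, hrsp, hsr, h3]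
    simp
  have hG : N • (p * (s * p)) = s * p - (N - 1) • (r * (t * (s * p))) := by
    rw [← smul_mul_assoc, hp, sub_mul, hrsp, smul_mul_assoc, mul_assoc, mul_assoc, hrsp]
  have h := congrArg (s * ·) ha
  simp only [mul_smul_comm, mul_sub, mul_assoc] at h ha
  rw [hF] at h
  have : (N + 1) • (s * a) = (N + 1) • (-a) := by
    rw [h, smul_neg, ha, hG]; abel
  exact (smul_right_injective A hN1) this

theorem antisymmetrizer_spec {α : EndStar A} {s : A} (hss : s * s = 1) (hs : star s = s)
    (hcomm : ∀ x, s * α (α x) = α (α x) * s) (hbraid : s * α s * s = α s * s * α s) (n : ℕ) :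
    star (antisymmetrizer α s n) = antisymmetrizer α s n ∧
    antisymmetrizer α s n * antisymmetrizer α s n = antisymmetrizer α s n ∧
    α (antisymmetrizer α s n) * antisymmetrizer α s (n + 1) = antisymmetrizer α s (n + 1) ∧
    s * antisymmetrizer α s (n + 2) = -antisymmetrizer α s (n + 2) := by
  have hN (n : ℕ) : ((n : ℂ) + 1) ≠ 0 := Nat.cast_add_one_ne_zero n
  have hrec (n : ℕ) : ((n : ℂ) + 1) • antisymmetrizer α s (n + 1) = α (antisymmetrizer α s n) -
      (n : ℂ) • (α (antisymmetrizer α s n) * s * α (antisymmetrizer α s n)) := by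
    rw [antisymmetrizer, smul_inv_smul₀ (hN n)]
  have hstar (n : ℕ) : star (antisymmetrizer α s n) = antisymmetrizer α s n := by
    induction n with
    | zero => simp [antisymmetrizer]
    | succ n ih =>
      rw [antisymmetrizer, star_smul, star_sub, star_smul, star_mul, star_mul, ← map_star, ih, hs]
      simp [mul_assoc]
  have h1 : antisymmetrizer α s 1 = 1 := by simp [antisymmetrizer]
  have habs (n : ℕ) (hi : antisymmetrizer α s n * antisymmetrizer α s n = antisymmetrizer α s n) :
      α (antisymmetrizer α s n) * antisymmetrizer α s (n + 1) = antisymmetrizer α s (n + 1) := by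
    rw [antisymmetrizer, mul_smul_comm, mul_sub, mul_smul_comm, ← mul_assoc, ← mul_assoc,
      ← map_mul, hi]
  have hidem (n : ℕ) (hi : antisymmetrizer α s n * antisymmetrizer α s n = antisymmetrizer α s n)
      (hsa : s * antisymmetrizer α s (n + 1) = -antisymmetrizer α s (n + 1)) :
      antisymmetrizer α s (n + 1) * antisymmetrizer α s (n + 1)
        = antisymmetrizer α s (n + 1) := by
    have hsa' : antisymmetrizer α s (n + 1) * s = -antisymmetrizer α s (n + 1) := by
      have := congrArg star hsa
      rwa [star_mul, hs, star_neg, hstar] at this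
    have hpa : antisymmetrizer α s (n + 1) * α (antisymmetrizer α s n)
        = antisymmetrizer α s (n + 1) := by
      have := congrArg star (habs n hi)
      rwa [star_mul, ← map_star, hstar, hstar] at this
    apply smul_right_injective A (hN n)
    simp only
    conv_lhs =>
      rw [← mul_smul_comm, hrec, mul_sub, hpa, mul_smul_comm, ← mul_assoc, ← mul_assoc, hpa, hsa',
        neg_mul, hpa, smul_neg]
    rw [add_smul, one_smul]
    abel
  -- The sign rule starts at index `2`, since the elements of index `0` and `1` are both `1`.
  -- Idempotence at `n + 2` uses the sign rule at `n + 2`; the sign rule at `n + 3` uses the sign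
  -- rule at `n + 2` and idempotence at `n + 1`. Hence the shifted pair.
  suffices h : ∀ n, antisymmetrizer α s (n + 1) * antisymmetrizer α s (n + 1)
        = antisymmetrizer α s (n + 1) ∧
      s * antisymmetrizer α s (n + 2) = -antisymmetrizer α s (n + 2) by
    have hi : ∀ n, antisymmetrizer α s n * antisymmetrizer α s n = antisymmetrizer α s n := by
      rintro (_ | n)
      · simp [antisymmetrizer]
      · exact (h n).1
    exact ⟨hstar n, hi n, habs n (hi n), (h n).2⟩
  intro n
  induction n with
  | zero =>
    refine ⟨by rw [h1, one_mul], ?_⟩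
    have := hrec 1
    rw [h1, map_one, one_mul, mul_one] at this
    apply smul_right_injective A (hN 1)
    simp only
    rw [← mul_smul_comm, smul_neg, this]
    simp [mul_sub, hss]
  | succ n ih =>
    have hi := hidem (n + 1) ih.1 ih.2
    refine ⟨hi, antisymmetrizer_step (N := ((n + 1 : ℕ) : ℂ) + 1)
      (r := α (α (antisymmetrizer α s (n + 1)))) (p := α (antisymmetrizer α s (n + 2))) (t := α s)
      ?_ ?_ ?_ ?_ (hcomm _).symm hss hbraid ?_⟩
    · have := hN (n + 2); push_cast at this ⊢; rwa [show (n : ℂ) + 1 + 1 = n + 2 by ring]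
    · rw [← map_smul, hrec (n + 1)]; simp
    · rw [← map_mul, habs _ ih.1]
    · rw [← map_mul, ih.2, map_neg]
    · have := hrec (n + 2); push_cast at this ⊢; rwa [show (n : ℂ) + 1 + 1 = n + 2 by ring]

end StarAlgebra

/-! ### Projections in finite-dimensional algebras and Gram-Schmidt -/

section FiniteDimensional

variable {A : Type*} [CStarAlgebra A]

/-- A closed finite-dimensional star subalgebra that is not one-dimensional contains a
nontrivial projection. -/
theorem StarSubalgebra.exists_isStarProjection [Nontrivial A] (B : StarSubalgebra ℂ A)
    (hB : IsClosed (B : Set A)) [FiniteDimensional ℂ B]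
    (hne : ∃ X ∈ B, ∀ c : ℂ, X ≠ c • (1 : A)) :
    ∃ E ∈ B, IsStarProjection E ∧ E ≠ 0 ∧ E ≠ 1 := by
  -- If the real and imaginary parts of an element are scalar, so is the element.
  obtain ⟨X, hXB, hX, hXne⟩ : ∃ X ∈ B, IsSelfAdjoint X ∧ ∀ c : ℂ, X ≠ c • (1 : A) := by
    obtain ⟨X, hXB, hXne⟩ := hne
    by_contra! h
    obtain ⟨a, ha⟩ := h (X + star X) (add_mem hXB (star_mem hXB)) (.add_star_self X)
    obtain ⟨b, hb⟩ := h (Complex.I • (X - star X))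
      (SMulMemClass.smul_mem _ (sub_mem hXB (star_mem hXB))) (by
        rw [IsSelfAdjoint, star_smul, star_sub, star_star, Complex.star_def, Complex.conj_I,
          neg_smul, ← smul_neg, neg_sub])
    apply hXne ((a - Complex.I * b) / 2)
    have hb' : X - star X = (-(Complex.I * b)) • (1 : A) := by
      rw [← neg_mul, mul_smul, ← hb, smul_smul]; simp
    have h2 : (2 : ℂ) • X = (a - Complex.I * b) • (1 : A) := by
      rw [sub_eq_add_neg, add_smul, ← ha, ← hb', two_smul]; abel
    rw [div_eq_inv_mul, mul_smul, ← h2, smul_smul]; simp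
  -- `X` is a root of a monic polynomial, which vanishes on the spectrum. On a finite spectrum the
  -- indicator of one point is continuous, and its functional calculus is the projection.
  have hfin : (spectrum ℂ X).Finite := by
    obtain ⟨p, hp, hpX⟩ := IsIntegral.of_finite ℂ (⟨X, hXB⟩ : B)
    have hpX' : Polynomial.aeval X p = 0 := by
      have := Polynomial.aeval_algHom_apply B.toSubalgebra.val ⟨X, hXB⟩ p
      rw [Polynomial.aeval_def _ p] at this
      exact this.trans ((congrArg _ hpX).trans (map_zero _))
    refine (p.roots.toFinset.finite_toSet).subset fun z hz => ?_
    have h1 : p.eval z ∈ spectrum ℂ (Polynomial.aeval X p) :=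
      spectrum.subset_polynomial_aeval X p ⟨z, hz, rfl⟩
    rw [hpX', spectrum.zero_eq] at h1
    simpa [hp.ne_zero] using h1
  obtain ⟨l, hl⟩ := spectrum.nonempty X
  obtain ⟨m, hm, hml⟩ : ∃ m ∈ spectrum ℂ X, m ≠ l := by
    by_contra! h
    apply hXne l
    have h1 : cfc (id : ℂ → ℂ) X = cfc (fun _ => l) X := cfc_congr fun z hz => h z hz
    rwa [cfc_id ℂ X hX.isStarNormal, cfc_const l X hX.isStarNormal,
      Algebra.algebraMap_eq_smul_one] at h1
  let f : ℂ → ℂ := fun z => if z = l then 1 else 0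
  have hf : ContinuousOn f (spectrum ℂ X) := hfin.continuousOn _
  have hspec := cfc_map_spectrum f X hX.isStarNormal hf
  refine ⟨cfc f X, ?_, ⟨?_, ?_⟩, fun h => ?_, fun h => ?_⟩
  · exact StarAlgebra.elemental.le_of_mem hB hXB (cfc_mem_elemental f X)
  · rw [IsIdempotentElem, ← cfc_mul f f X]
    exact cfc_congr fun z _ => by simp [f]
  · rw [IsSelfAdjoint, ← cfc_star f X]
    exact cfc_congr fun z _ => by simp only [f]; split_ifs <;> simp
  · have h1 : (1 : ℂ) ∈ spectrum ℂ (cfc f X) := hspec ▸ ⟨l, hl, by simp [f]⟩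
    rw [h, spectrum.zero_eq] at h1
    simp at h1
  · have h1 : (0 : ℂ) ∈ spectrum ℂ (cfc f X) := hspec ▸ ⟨m, hm, by simp [f, hml]⟩
    rw [h, spectrum.one_eq] at h1
    simp at h1

/-- If `X* Y` is a scalar for all `X, Y ∈ H`, and the orthonormal families in `H` have at most `N`
members, then `H` has a finite orthonormal basis. -/
theorem Submodule.exists_orthonormal_of_star_mul_scalar [Nontrivial A] (H : Submodule ℂ A)
    (hH : ∀ X ∈ H, ∀ Y ∈ H, ∃ c : ℂ, star X * Y = c • (1 : A)) (N : ℕ)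
    (hN : ∀ (n : ℕ) (e : ℕ → A), (∀ i < n, e i ∈ H) →
      (∀ i < n, ∀ j < n, star (e i) * e j = if i = j then 1 else 0) → n ≤ N) :
    FiniteDimensional ℂ H ∧ ∃ e : ℕ → A, (∀ i < Module.finrank ℂ H, e i ∈ H) ∧
      (∀ i < Module.finrank ℂ H, ∀ j < Module.finrank ℂ H,
        star (e i) * e j = if i = j then 1 else 0) ∧
      ∀ X ∈ H, ∑ i ∈ Finset.range (Module.finrank ℂ H), e i * star (e i) * X = X := by
  classical
  let P : ℕ → Prop := fun n => ∃ e : ℕ → A, (∀ i < n, e i ∈ H) ∧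
    (∀ i < n, ∀ j < n, star (e i) * e j = if i = j then 1 else 0)
  have hP0 : P 0 := ⟨0, by simp, by simp⟩
  have hP : P (Nat.findGreatest P N) := Nat.findGreatest_spec (Nat.zero_le N) hP0
  have hPmax : ¬ P (Nat.findGreatest P N + 1) := by
    rintro h
    obtain ⟨e, he, heo⟩ := id h
    exact Nat.findGreatest_is_greatest (Nat.lt_succ_self _) (hN _ e he heo) h
  generalize Nat.findGreatest P N = n at hP hPmax
  obtain ⟨e, he, heo⟩ := hP
  have hsum : ∀ X ∈ H, ∑ i ∈ Finset.range n, e i * star (e i) * X = X := by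
    intro X hX
    by_contra hne
    apply hPmax
    -- The Gram-Schmidt remainder: if nonzero, its normalization would extend a family of maximal
    -- length.
    set w := X - ∑ i ∈ Finset.range n, e i * star (e i) * X with hw
    have hw0 : w ≠ 0 := fun h => hne (sub_eq_zero.mp h).symm
    have hwH : w ∈ H := by
      refine H.sub_mem hX (H.sum_mem fun i hi => ?_)
      obtain ⟨c, hc⟩ := hH _ (he i (Finset.mem_range.mp hi)) _ hX
      rw [mul_assoc, hc, mul_smul_comm, mul_one]
      exact H.smul_mem _ (he i (Finset.mem_range.mp hi))
    have hew : ∀ j < n, star (e j) * w = 0 := by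
      intro j hj
      rw [hw, mul_sub, Finset.mul_sum, Finset.sum_eq_single_of_mem j (Finset.mem_range.mpr hj),
        ← mul_assoc, ← mul_assoc, heo j hj j hj]
      · simp
      · intro i hi hij
        rw [← mul_assoc, ← mul_assoc, heo j hj i (Finset.mem_range.mp hi), if_neg hij.symm]
        simp
    have hwe : ∀ j < n, star w * e j = 0 := by
      intro j hj
      have := congrArg star (hew j hj)
      simpa using this
    obtain ⟨c, hc⟩ := hH w hwH w hwH
    obtain ⟨r, hr, rfl⟩ := exists_nonneg_of_star_mul_self_eq_smul_one hc
    have hr0 : r ≠ 0 := by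
      rintro rfl
      rw [Complex.ofReal_zero, zero_smul] at hc
      exact hw0 ((CStarRing.star_mul_self_eq_zero_iff w).mp hc)
    let v := (((Real.sqrt r)⁻¹ : ℝ) : ℂ) • w
    have hv : star v * v = 1 := by
      simp only [v]
      rw [star_smul, smul_mul_smul_comm, hc, smul_smul, Complex.star_def, Complex.conj_ofReal,
        ← Complex.ofReal_mul, ← Complex.ofReal_mul]
      have : (Real.sqrt r)⁻¹ * (Real.sqrt r)⁻¹ * r = 1 := by
        rw [← mul_inv, Real.mul_self_sqrt hr, inv_mul_cancel₀ hr0]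
      rw [this]; simp
    refine ⟨fun i => if i < n then e i else v, fun i _ => ?_, fun i hi j hj => ?_⟩
    · by_cases h : i < n
      · simpa [h] using he i h
      · simpa [h] using H.smul_mem _ hwH
    · by_cases h : i < n <;> by_cases h' : j < n <;> simp only [h, h', if_true, if_false]
      · exact heo i h j h'
      · rw [if_neg (by omega)]
        simp only [v]; rw [mul_smul_comm, hew i h, smul_zero]
      · rw [if_neg (by omega)]
        simp only [v]; rw [star_smul, smul_mul_assoc, hwe j h', smul_zero]
      · rw [if_pos (by omega), hv]
  have hli : LinearIndependent ℂ (fun i : Fin n => e i) := by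
    rw [Fintype.linearIndependent_iff]
    intro g hg i
    have := congrArg (star (e i) * ·) hg
    simp only [Finset.mul_sum, mul_smul_comm, mul_zero] at this
    rw [Finset.sum_eq_single i (fun j _ hj => by
      rw [heo i i.2 j j.2, if_neg (fun h => hj (Fin.ext h.symm)), smul_zero]) (by simp),
      heo i i.2 i i.2, if_pos rfl] at this
    exact (smul_eq_zero.mp this).resolve_right one_ne_zero
  have hspan : H = Submodule.span ℂ (Set.range fun i : Fin n => e i) := by
    apply le_antisymm
    · intro X hX
      rw [← hsum X hX]
      refine Submodule.sum_mem _ fun i hi => ?_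
      have hi := Finset.mem_range.mp hi
      obtain ⟨c, hc⟩ := hH _ (he i hi) _ hX
      rw [mul_assoc, hc, mul_smul_comm, mul_one]
      exact Submodule.smul_mem _ _ (Submodule.subset_span ⟨⟨i, hi⟩, rfl⟩)
    · rw [Submodule.span_le]
      rintro _ ⟨i, rfl⟩
      exact he i i.2
  have hrank : Module.finrank ℂ H = n := by
    rw [hspan, finrank_span_eq_card hli, Fintype.card_fin]
  refine ⟨?_, e, ?_⟩
  · rw [hspan]; exact FiniteDimensional.span_of_finite ℂ (Set.finite_range _)
  · rw [hrank]; exact ⟨he, heo, hsum⟩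

end FiniteDimensional

/-! ### Partial traces, the trace property and integrality of the dimension -/

namespace SymmetricSubcategory

variable {A : Type*} [CStarAlgebra A] {T : EndCategory A} (C : SymmetricSubcategory T)
  {α β γ : EndStar A}

theorem intertwine (hα : α ∈ T.Ob) (hβ : β ∈ T.Ob) {X : A} (hX : X ∈ C.hom α β) (x : A) :
    X * α x = β x * X :=
  C.hom_le α hα β hβ hX x

theorem R_mul (hα : α ∈ T.Ob) (x : A) : C.R α * x = C.conj α (α x) * C.R α :=
  C.intertwine T.id_mem (T.comp_mem _ (C.conj_mem α hα) _ hα) (C.R_mem α hα) x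

theorem S_mul (hα : α ∈ T.Ob) (x : A) : C.S α * x = α (C.conj α x) * C.S α :=
  C.intertwine T.id_mem (T.comp_mem _ hα _ (C.conj_mem α hα)) (C.S_mem α hα) x

theorem mul_star_R (hα : α ∈ T.Ob) (x : A) :
    x * star (C.R α) = star (C.R α) * C.conj α (α x) := by
  have := congrArg star (C.R_mul hα (star x))
  simpa [← map_star] using this

theorem mul_star_S (hα : α ∈ T.Ob) (x : A) :
    x * star (C.S α) = star (C.S α) * α (C.conj α x) := by
  have := congrArg star (C.S_mul hα (star x))
  simpa [← map_star] using this

theorem star_ε (hα : α ∈ T.Ob) (hβ : β ∈ T.Ob) : star (C.ε α β) = C.ε β α := by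
  have h1 := (C.ε_unitary α hα β hβ)
  calc star (C.ε α β) = star (C.ε α β) * (C.ε α β * C.ε β α) := by
        rw [C.ε_symm α hα β hβ, mul_one]
    _ = C.ε β α := by rw [← mul_assoc, Unitary.star_mul_self_of_mem h1, one_mul]

theorem ε_mul_left (hα : α ∈ T.Ob) (hβ : β ∈ T.Ob) (hγ : γ ∈ T.Ob) {X : A}
    (hX : X ∈ C.hom α β) : C.ε β γ * X = γ X * C.ε α γ := by
  simpa using C.ε_natural α hα β hβ γ hγ γ hγ X hX 1 (C.one_mem γ hγ)

theorem ε_mul_right (hα : α ∈ T.Ob) (hβ : β ∈ T.Ob) (hγ : γ ∈ T.Ob) {Y : A}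
    (hY : Y ∈ C.hom α β) : C.ε γ β * γ Y = Y * C.ε γ α := by
  simpa using C.ε_natural γ hγ γ hγ α hα β hβ 1 (C.one_mem γ hγ) Y hY

/-- Naturality of `ε` in the arrow `R`, with `ε(ᾱα, α) = ε(ᾱ, α) ᾱ(ε(α, α))`, reduces the partial
trace of the flip to `S* α(R)`. -/
theorem star_R_mul_conj_ε_mul_R (hα : α ∈ T.Ob) :
    star (C.R α) * C.conj α (C.ε α α) * C.R α = 1 := by
  have hc := C.conj_mem α hα
  have h1 := C.ε_mul_left T.id_mem (T.comp_mem _ hc _ hα) hα (C.R_mem α hα)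
  rw [C.ε_id_left α hα, mul_one, C.ε_comp _ hc _ hα _ hα] at h1
  have h2 : C.conj α (C.ε α α) * C.R α = C.ε α (C.conj α) * α (C.R α) := by
    rw [← h1, ← mul_assoc, ← mul_assoc, C.ε_symm _ hα _ hc, one_mul]
  rw [mul_assoc, h2, ← mul_assoc, ← C.star_ε hc hα, ← star_mul, ← C.S_eq α hα,
    C.conj_eq_left α hα]

theorem map_star_S_mul_ε_mul_map_S (hα : α ∈ T.Ob) :
    α (star (C.S α)) * C.ε α α * α (C.S α) = 1 := by
  have hc := C.conj_mem α hα
  have h1 := C.ε_mul_left T.id_mem (T.comp_mem _ hα _ hc) hα (C.S_mem α hα)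
  rw [C.ε_id_left α hα, mul_one] at h1
  have h2 : C.ε α α * α (C.S α) = C.ε (α.comp (C.conj α)) α * α (C.R α) := by
    rw [C.S_eq α hα, map_mul, ← mul_assoc, C.ε_comp _ hα _ hc _ hα]
  have h3 := Unitary.star_mul_self_of_mem (C.ε_unitary _ (T.comp_mem _ hα _ hc) α hα)
  rw [mul_assoc, h2, ← mul_assoc, map_star, ← h1, star_mul, mul_assoc (star (C.S α)), h3, mul_one,
    C.conj_eq_left α hα]

/-- The trace property. -/
theorem star_S_mul_mul_S (hα : α ∈ T.Ob) (hβ : β ∈ T.Ob) {X Y : A} (hX : X ∈ C.hom α β)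
    (hY : Y ∈ C.hom β α) :
    star (C.S β) * (X * Y) * C.S β = star (C.R α) * C.conj α (Y * X) * C.R α := by
  -- The twisted arrow `t` on `αβ` has partial trace `X Y` over `α` and `Y X` over `β`. Taking the
  -- remaining trace in either order gives the same scalar product with `R_α S_β`.
  set t := Y * C.ε β β * X with ht
  have ht' : t = α X * C.ε α α * α Y := by
    rw [ht, ← C.ε_mul_right hβ hα hβ hY, mul_assoc,
      ← C.intertwine hα hβ hX, ← mul_assoc, C.ε_mul_left hα hβ hα hX]
  have h1 : star (C.R α) * C.conj α t * C.R α = X * Y := by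
    rw [ht', map_mul, map_mul]
    calc _ = (star (C.R α) * C.conj α (α X)) * C.conj α (C.ε α α) *
          (C.conj α (α Y) * C.R α) := by simp only [mul_assoc]
      _ = X * (star (C.R α) * C.conj α (C.ε α α) * C.R α) * Y := by
          rw [← C.mul_star_R hα, ← C.R_mul hα]; simp only [mul_assoc]
      _ = _ := by rw [C.star_R_mul_conj_ε_mul_R hα, mul_one]
  have h2 : α (star (C.S β)) * t * α (C.S β) = Y * X := by
    calc _ = (α (star (C.S β)) * Y) * C.ε β β * (X * α (C.S β)) := by
          rw [ht]; simp only [mul_assoc]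
      _ = Y * (β (star (C.S β)) * C.ε β β * β (C.S β)) * X := by
          rw [← C.intertwine hβ hα hY, C.intertwine hα hβ hX]; simp only [mul_assoc]
      _ = _ := by rw [C.map_star_S_mul_ε_mul_map_S hβ, mul_one]
  clear_value t
  rw [← h1, ← h2, map_mul, map_mul]
  calc _ = (star (C.S β) * star (C.R α)) * C.conj α t * (C.R α * C.S β) := by
        simp only [mul_assoc]
    _ = _ := by rw [C.R_mul hα, C.mul_star_R hα]; simp only [mul_assoc]

theorem star_S_mul_S (hα : α ∈ T.Ob) : star (C.S α) * C.S α = C.dim α • (1 : A) := by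
  have := C.star_S_mul_mul_S hα hα (C.one_mem α hα) (C.one_mem α hα)
  simpa [C.dim_spec α hα] using this

/-- This is naturality of `ε` applied to the arrow `ε(α, α)` itself. -/
theorem braid (hα : α ∈ T.Ob) :
    C.ε α α * α (C.ε α α) * C.ε α α = α (C.ε α α) * C.ε α α * α (C.ε α α) := by
  have hαα := T.comp_mem _ hα _ hα
  have h := C.ε_mul_left hαα hαα hα (C.ε_mem α hα α hα)
  rwa [C.ε_comp _ hα _ hα _ hα, ← mul_assoc] at h

variable [Nontrivial A]

theorem R_ne_zero (hα : α ∈ T.Ob) : C.R α ≠ 0 := fun h => by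
  have := C.conj_eq_left α hα
  simp [h] at this

/-- The dimension of an object is a positive integer. -/
theorem exists_dim_eq_natCast (hα : α ∈ T.Ob) : ∃ n : ℕ, 0 < n ∧ C.dim α = n := by
  obtain ⟨d, hd0, hd⟩ := exists_nonneg_of_star_mul_self_eq_smul_one (C.dim_spec α hα).symm
  have hs : star (C.ε α α) = C.ε α α := C.star_ε hα hα
  have hspec := antisymmetrizer_spec (C.ε_symm α hα α hα) hs
    (fun x => C.intertwine (T.comp_mem _ hα _ hα) (T.comp_mem _ hα _ hα)
      (C.ε_mem α hα α hα) x) (C.braid hα)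
  set a := antisymmetrizer α (C.ε α α) with ha
  have hdim : star (C.R α) * C.R α = (d : ℂ) • (1 : A) := by rw [← C.dim_spec α hα, hd]
  -- Apply the partial trace to the recursion: `α(a n)` contributes `d a n`, and `α(a n) s α(a n)`
  -- contributes `a n` because the flip has trace `1`.
  have htr (n : ℕ) : ((n : ℂ) + 1) • (star (C.R α) * C.conj α (a (n + 1)) * C.R α) =
      ((d : ℂ) - n) • a n := by
    have h1 : star (C.R α) * C.conj α (α (a n)) * C.R α = (d : ℂ) • a n := by
      rw [← C.mul_star_R hα, mul_assoc, hdim, mul_smul_comm, mul_one]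
    have h2 : star (C.R α) * C.conj α (α (a n) * C.ε α α * α (a n)) * C.R α = a n := by
      rw [map_mul, map_mul]
      calc _ = (star (C.R α) * C.conj α (α (a n))) * C.conj α (C.ε α α) *
            (C.conj α (α (a n)) * C.R α) := by simp only [mul_assoc]
        _ = a n * (star (C.R α) * C.conj α (C.ε α α) * C.R α) * a n := by
            rw [← C.mul_star_R hα, ← C.R_mul hα]; simp only [mul_assoc]
        _ = _ := by rw [C.star_R_mul_conj_ε_mul_R hα, mul_one, (hspec n).2.1]
    rw [← smul_mul_assoc, ← mul_smul_comm, ← map_smul]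
    have h3 : ((n : ℂ) + 1) • a (n + 1) = α (a n) - (n : ℂ) • (α (a n) * C.ε α α * α (a n)) := by
      rw [ha, antisymmetrizer, smul_inv_smul₀ (Nat.cast_add_one_ne_zero n)]
    rw [h3, map_sub, map_smul, mul_sub, sub_mul, mul_smul_comm, smul_mul_assoc, h1, h2, sub_smul]
  have hnat : ∃ n : ℕ, d = n := by
    by_contra! hne
    have hne0 (n : ℕ) : a n ≠ 0 := by
      induction n with
      | zero => rw [ha, antisymmetrizer]; exact one_ne_zero
      | succ n ih =>
        intro h
        have := htr n
        rw [h, map_zero, mul_zero, zero_mul, smul_zero] at this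
        refine hne n ?_
        have := (smul_eq_zero.mp this.symm).resolve_right ih
        exact_mod_cast sub_eq_zero.mp this
    obtain ⟨n, hn⟩ := exists_nat_gt d
    -- Both `a n` and `a (n + 1)` are projections, so the partial trace of `a (n + 1)` is `y* y` and
    -- equals this scalar times `(a n)* (a n)`.
    have hpos : (0 : ℝ) ≤ (d - n) / (n + 1) := by
      refine nonneg_of_star_mul_self_eq_smul (y := C.conj α (a (n + 1)) * C.R α) (z := a n)
        (hne0 n) ?_
      rw [star_mul, ← map_star, (hspec n).1, (hspec (n + 1)).1, (hspec n).2.1, mul_assoc,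
        ← mul_assoc (C.conj α _), ← map_mul, (hspec (n + 1)).2.1, ← mul_assoc]
      apply smul_right_injective A (Nat.cast_add_one_ne_zero (R := ℂ) n)
      simp only
      rw [htr, smul_smul]
      congr 1
      push_cast
      field_simp [Nat.cast_add_one_ne_zero (R := ℂ) n]
    have : (d - n) / (n + 1) < 0 := div_neg_of_neg_of_pos (by linarith) (by positivity)
    linarith
  obtain ⟨n, rfl⟩ := hnat
  refine ⟨n, Nat.pos_of_ne_zero ?_, by simpa using hd⟩
  rintro rfl
  rw [Nat.cast_zero, Complex.ofReal_zero, zero_smul] at hdim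
  exact C.R_ne_zero hα ((CStarRing.star_mul_self_eq_zero_iff _).mp hdim)

end SymmetricSubcategory

/-! ### Additivity, Frobenius reciprocity and irreducible decompositions -/

namespace SymmetricSubcategory

variable {A : Type*} [CStarAlgebra A] {T : EndCategory A} (C : SymmetricSubcategory T)
  {α β ρ σ : EndStar A}

theorem star_S_mul_mul_star_mul_S (hα : α ∈ T.Ob) (hβ : β ∈ T.Ob) {W : A} (hW : W ∈ C.hom β α)
    (hi : IsIsom W) : star (C.S α) * (W * star W) * C.S α = C.dim β • (1 : A) := by
  rw [C.star_S_mul_mul_S hβ hα hW (C.star_mem _ hβ _ hα _ hW), hi, map_one, mul_one,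
    C.dim_spec β hβ]

theorem sum_dim_smul_one (hα : α ∈ T.Ob) {ι : Type*} (s : Finset ι) (σ : ι → EndStar A)
    (W : ι → A) (hσ : ∀ i ∈ s, σ i ∈ T.Ob) (hW : ∀ i ∈ s, W i ∈ C.hom (σ i) α)
    (hi : ∀ i ∈ s, IsIsom (W i)) :
    (∑ i ∈ s, C.dim (σ i)) • (1 : A) =
      star (C.S α) * (∑ i ∈ s, W i * star (W i)) * C.S α := by
  rw [Finset.mul_sum, Finset.sum_mul, Finset.sum_smul]
  exact Finset.sum_congr rfl fun i h =>
    (C.star_S_mul_mul_star_mul_S hα (hσ i h) (hW i h) (hi i h)).symm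

theorem scalar_of_mem_hom_id {X : A} (hX : X ∈ C.hom (idEnd A) (idEnd A)) :
    ∃ c : ℂ, X = c • (1 : A) := by
  rw [C.hom_id, Submodule.mem_span_singleton] at hX
  obtain ⟨c, hc⟩ := hX
  exact ⟨c, hc.symm⟩

theorem map_star_R_mul_S (hα : α ∈ T.Ob) : α (star (C.R α)) * C.S α = 1 := by
  have := congrArg star (C.conj_eq_left α hα)
  simpa [← map_star] using this

theorem mul_S_mem (hα : α ∈ T.Ob) {X : A} (hX : X ∈ C.hom α α) :
    X * C.S α ∈ C.hom (idEnd A) (α.comp (C.conj α)) := by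
  have hc := T.comp_mem _ hα _ (C.conj_mem α hα)
  exact C.mul_mem _ T.id_mem _ hc _ hc _
    (C.whisker_mem _ hα _ hα _ (C.conj_mem α hα) _ hX) _ (C.S_mem α hα)

/-- The inverse half of Frobenius reciprocity: `X ↦ X S` is injective. -/
theorem eq_map_star_R_mul (hα : α ∈ T.Ob) {X : A} (hX : X ∈ intertwiners α α) :
    X = α (star (C.R α)) * (X * C.S α) := by
  rw [← mul_assoc, ← hX, mul_assoc, C.map_star_R_mul_S hα, mul_one]

/-- Generation of `(ρ, ρ)` itself would only give elements of `ρ(Z)`. Moving to `(ι, ρ ρ̄)` by `X ↦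
X S` puts the central coefficients at source `ι`, where they stay in `Z`. The `T_ℂ`-arrows there are
multiples of `S`, so `X S = S z`, and Frobenius reciprocity returns `X = z`. -/
theorem irr_of_scalar (hρ : ρ ∈ T.Ob) (h : ∀ X ∈ C.hom ρ ρ, ∃ c : ℂ, X = c • (1 : A)) :
    ρ ∈ T.Irr := by
  refine ⟨hρ, Set.Subset.antisymm (fun X hX => ?_) (fun X hX a => ?_)⟩
  · have hc := T.comp_mem _ hρ _ (C.conj_mem ρ hρ)
    have hXS : X * C.S ρ ∈ intertwiners (idEnd A) (ρ.comp (C.conj ρ)) := fun a => by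
      change X * C.S ρ * a = ρ (C.conj ρ a) * (X * C.S ρ)
      rw [mul_assoc, C.S_mul hρ, ← mul_assoc, hX, mul_assoc]
    rw [C.generates _ T.id_mem _ hc] at hXS
    have hz : ∃ z ∈ Set.center A, X * C.S ρ = C.S ρ * z := by
      refine Submodule.span_induction ?_ ?_ ?_ ?_ hXS
      · rintro _ ⟨F, hF, z, hz, rfl⟩
        have hF' : ρ (star (C.R ρ)) * F ∈ C.hom ρ ρ := by
          have h1 : ρ (star (C.R ρ)) ∈ C.hom (ρ.comp ((C.conj ρ).comp ρ)) (ρ.comp (idEnd A)) :=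
            C.map_mem _ hρ _ (T.comp_mem _ (C.conj_mem ρ hρ) _ hρ) _ T.id_mem _
              (C.star_mem _ T.id_mem _ (T.comp_mem _ (C.conj_mem ρ hρ) _ hρ) _ (C.R_mem ρ hρ))
          exact C.mul_mem _ hρ _ (T.comp_mem _ hc _ hρ) _ hρ _ h1 _
            (C.whisker_mem _ T.id_mem _ hc _ hρ _ hF)
        obtain ⟨c, hcF⟩ := h _ hF'
        have hFS : F = c • C.S ρ := by
          have h3 : F * C.S ρ = ρ (C.conj ρ (C.S ρ)) * F := C.intertwine T.id_mem hc hF _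
          calc F = ρ (star (C.R ρ) * C.conj ρ (C.S ρ)) * F := by
                rw [C.conj_eq_right ρ hρ, map_one, one_mul]
            _ = ρ (star (C.R ρ)) * F * C.S ρ := by rw [map_mul, mul_assoc, ← h3, mul_assoc]
            _ = c • C.S ρ := by rw [hcF, smul_mul_assoc, one_mul]
        refine ⟨c • z, Set.smul_mem_center c hz, ?_⟩
        rw [hFS, smul_mul_assoc, mul_smul_comm]; rfl
      · exact ⟨0, Set.zero_mem_center, by simp⟩
      · rintro _ _ _ _ ⟨z, hz, rfl⟩ ⟨w, hw, rfl⟩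
        exact ⟨z + w, Set.add_mem_center hz hw, by rw [mul_add]⟩
      · rintro c _ _ ⟨z, hz, rfl⟩
        exact ⟨c • z, Set.smul_mem_center c hz, by rw [mul_smul_comm]⟩
    obtain ⟨z, hz, hXz⟩ := hz
    rw [C.eq_map_star_R_mul hρ hX, hXz, ← mul_assoc, C.map_star_R_mul_S hρ, one_mul]
    exact hz
  · exact (Set.mem_center_iff.mp hX).comm _

/-- The arrows from an object to itself, as a star subalgebra. -/
def endAlgebra (hα : α ∈ T.Ob) : StarSubalgebra ℂ A where
  carrier := C.hom α α
  mul_mem' := fun {X Y} hX hY => C.mul_mem _ hα _ hα _ hα X hX Y hY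
  add_mem' := (C.hom α α).add_mem
  algebraMap_mem' := fun c => by
    rw [Algebra.algebraMap_eq_smul_one]
    exact (C.hom α α).smul_mem c (C.one_mem α hα)
  star_mem' := fun {X} hX => C.star_mem _ hα _ hα X hX

/-- `e 0, …, e (m - 1)`, where `m = m(ρ, α)`, is an orthonormal basis of the arrows from `ρ`
to `α`. -/
structure IsOrthonormalBasis (ρ α : EndStar A) (e : ℕ → A) : Prop where
  mem : ∀ i < C.mult ρ α, e i ∈ C.hom ρ α
  star_mul : ∀ i < C.mult ρ α, ∀ j < C.mult ρ α, star (e i) * e j = if i = j then 1 else 0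
  sum_mul : ∀ X ∈ C.hom ρ α, ∑ i ∈ Finset.range (C.mult ρ α), e i * star (e i) * X = X

theorem sum_mul_star_conj {ι : Type*} [Fintype ι] (V : A) (X : ι → A)
    (h : ∑ i, X i * star (X i) = 1) : ∑ i, V * X i * star (V * X i) = V * star V := by
  calc _ = V * (∑ i, X i * star (X i)) * star V := by
        rw [Finset.mul_sum, Finset.sum_mul]
        exact Finset.sum_congr rfl fun i _ => by rw [star_mul]; simp only [mul_assoc]
    _ = _ := by rw [h, mul_one]

variable [Nontrivial A]

theorem smul_one_injective {c d : ℂ} (h : c • (1 : A) = d • (1 : A)) : c = d := by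
  rw [← sub_eq_zero, ← sub_smul] at h
  exact sub_eq_zero.mp ((smul_eq_zero.mp h).resolve_right one_ne_zero)

theorem dim_eq_sum (hα : α ∈ T.Ob) {ι : Type*} (s : Finset ι) (σ : ι → EndStar A)
    (W : ι → A) (hσ : ∀ i ∈ s, σ i ∈ T.Ob) (hW : ∀ i ∈ s, W i ∈ C.hom (σ i) α)
    (hi : ∀ i ∈ s, IsIsom (W i)) (h1 : ∑ i ∈ s, W i * star (W i) = 1) :
    C.dim α = ∑ i ∈ s, C.dim (σ i) := by
  apply smul_one_injective (A := A)
  rw [C.sum_dim_smul_one hα s σ W hσ hW hi, h1, mul_one, C.star_S_mul_S hα]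

/-- Orthonormal families of arrows from `ρ` to `α` have a bounded number of members. -/
theorem exists_bound_orthonormal (hρ : ρ ∈ T.Ob) (hα : α ∈ T.Ob) :
    ∃ N : ℕ, ∀ (n : ℕ) (e : ℕ → A), (∀ i < n, e i ∈ C.hom ρ α) →
      (∀ i < n, ∀ j < n, star (e i) * e j = if i = j then 1 else 0) → n ≤ N := by
  obtain ⟨N, -, hN⟩ := C.exists_dim_eq_natCast hα
  obtain ⟨k, hk, hk'⟩ := C.exists_dim_eq_natCast hρ
  refine ⟨N, fun n e he heo => ?_⟩
  have hsum := C.sum_dim_smul_one hα (Finset.range n) (fun _ => ρ) e (fun _ _ => hρ)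
    (fun i hi => he i (Finset.mem_range.mp hi)) (fun i hi => by
      have hi := Finset.mem_range.mp hi
      simpa [IsIsom] using heo i hi i hi)
  set p := ∑ i ∈ Finset.range n, e i * star (e i) with hp
  have hps : star p = p := by simp [hp, star_sum]
  have hpp : p * p = p := by
    conv_lhs => rw [hp, Finset.sum_mul_sum]
    rw [hp]
    refine Finset.sum_congr rfl fun i hi => ?_
    rw [Finset.sum_eq_single_of_mem i hi]
    · have hi := Finset.mem_range.mp hi
      rw [mul_assoc, ← mul_assoc (star (e i)), heo i hi i hi, if_pos rfl, one_mul]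
    · intro j hj hji
      rw [mul_assoc, ← mul_assoc (star (e i)),
        heo i (Finset.mem_range.mp hi) j (Finset.mem_range.mp hj), if_neg hji.symm, zero_mul,
        mul_zero]
  -- The complement of `n` copies of `ρ` has trace `N - n k`, which must be nonnegative; `k ≥ 1`
  -- then bounds `n` by `N`.
  have h : star ((1 - p) * C.S α) * ((1 - p) * C.S α)
      = ((N : ℂ) - n * k) • (1 : A) := by
    rw [star_mul, star_sub, star_one, hps, mul_assoc, ← mul_assoc (1 - p)]
    have : (1 - p) * (1 - p) = 1 - p := by
      rw [mul_sub, sub_mul, sub_mul, hpp]; simp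
    rw [this, ← mul_assoc, mul_sub, sub_mul, mul_one, C.star_S_mul_S hα, ← hsum, hN, ← sub_smul]
    simp [hk']
  obtain ⟨r, hr, hr'⟩ := exists_nonneg_of_star_mul_self_eq_smul_one h
  have h2 : (N : ℝ) - n * k = r := by exact_mod_cast hr'
  have h3 : n * k ≤ N := by
    have : (n : ℝ) * k ≤ N := by linarith
    exact_mod_cast this
  exact (Nat.le_mul_of_pos_right n hk).trans h3

theorem exists_isOrthonormalBasis_of_scalar (hρ : ρ ∈ T.Ob) (hα : α ∈ T.Ob)
    (hs : ∀ X ∈ C.hom ρ ρ, ∃ c : ℂ, X = c • (1 : A)) :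
    FiniteDimensional ℂ (C.hom ρ α) ∧ ∃ e, C.IsOrthonormalBasis ρ α e := by
  obtain ⟨N, hN⟩ := C.exists_bound_orthonormal hρ hα
  obtain ⟨h, e, h1, h2, h3⟩ := (C.hom ρ α).exists_orthonormal_of_star_mul_scalar
    (fun X hX Y hY => hs _ (C.mul_mem _ hρ _ hα _ hρ _ (C.star_mem _ hρ _ hα _ hX) _ hY)) N hN
  exact ⟨h, e, h1, h2, h3⟩

/-- Frobenius reciprocity embeds these arrows into arrows out of `ι`, which has scalar
endomorphisms, so orthonormal bases are available there without any irreducibility of `α`. -/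
theorem finiteDimensional_end (hα : α ∈ T.Ob) : FiniteDimensional ℂ (C.hom α α) := by
  have hc := T.comp_mem _ hα _ (C.conj_mem α hα)
  have := (C.exists_isOrthonormalBasis_of_scalar T.id_mem hc
    fun X hX => C.scalar_of_mem_hom_id hX).1
  let f : C.hom α α →ₗ[ℂ] C.hom (idEnd A) (α.comp (C.conj α)) :=
    (LinearMap.mulRight ℂ (C.S α)).restrict fun X hX => C.mul_S_mem hα hX
  refine FiniteDimensional.of_injective f fun X Y h => Subtype.ext ?_
  have h' : (X : A) * C.S α = Y * C.S α := congrArg Subtype.val h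
  rw [C.eq_map_star_R_mul hα (C.hom_le _ hα _ hα X.2), h',
    ← C.eq_map_star_R_mul hα (C.hom_le _ hα _ hα Y.2)]

theorem exists_isStarProjection (hα : α ∈ T.Ob)
    (h : ¬ ∀ X ∈ C.hom α α, ∃ c : ℂ, X = c • (1 : A)) :
    ∃ E ∈ C.hom α α, IsStarProjection E ∧ E ≠ 0 ∧ E ≠ 1 := by
  have : FiniteDimensional ℂ (C.endAlgebra hα) := C.finiteDimensional_end hα
  push Not at h
  exact (C.endAlgebra hα).exists_isStarProjection (C.isClosed_hom α hα α hα) h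

/-- A nontrivial projection would be `V V*` with `V` an isometry, and it is central; commuting it
past `V` forces `V V* = V* V = 1`. -/
theorem scalar_of_irr (hρ : ρ ∈ T.Irr) : ∀ X ∈ C.hom ρ ρ, ∃ c : ℂ, X = c • (1 : A) := by
  by_contra h
  obtain ⟨E, hE, hE1, hE2, hE3⟩ := C.exists_isStarProjection hρ.1 h
  obtain ⟨β, hβ, V, hV, hVi, rfl⟩ := C.subobject ρ hρ.1 E hE hE1 hE2
  have hc : V * star V ∈ Set.center A := hρ.2 ▸ C.hom_le _ hρ.1 _ hρ.1 hE
  apply hE3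
  have h1 : V * star V * V = V := by rw [mul_assoc, hVi, mul_one]
  calc V * star V = star V * V * (V * star V) := by rw [hVi, one_mul]
    _ = star V * (V * star V * V) := by
        rw [mul_assoc (star V), (Set.mem_center_iff.mp hc).comm V]
    _ = 1 := by rw [h1, hVi]

theorem exists_isOrthonormalBasis (hρ : ρ ∈ T.Irr) (hα : α ∈ T.Ob) :
    FiniteDimensional ℂ (C.hom ρ α) ∧ ∃ e, C.IsOrthonormalBasis ρ α e :=
  C.exists_isOrthonormalBasis_of_scalar hρ.1 hα (C.scalar_of_irr hρ)

/-- Schur's lemma. -/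
theorem exists_unitary_of_not_disjoint (hσ : σ ∈ T.Irr) (hρ : ρ ∈ T.Irr)
    (h : ¬ DisjointEnd σ ρ) : ∃ U ∈ C.hom σ ρ, U ∈ unitary A := by
  obtain ⟨F, hF, hF0⟩ : ∃ F ∈ C.hom σ ρ, F ≠ 0 := by
    by_contra! h0
    apply h
    rw [DisjointEnd, C.generates _ hσ.1 _ hρ.1, Submodule.span_eq_bot]
    rintro _ ⟨F, hF, z, -, rfl⟩
    rw [h0 F hF, zero_mul]
  obtain ⟨-, e, he⟩ := C.exists_isOrthonormalBasis hσ hρ.1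
  have hm : 0 < C.mult σ ρ := by
    by_contra! hm
    apply hF0
    rw [← he.sum_mul F hF, Nat.le_zero.mp hm, Finset.sum_range_zero]
  have h1 : star (e 0) * e 0 = 1 := by simpa using he.star_mul 0 hm 0 hm
  refine ⟨e 0, he.mem 0 hm, Unitary.mem_iff.mpr ⟨h1, ?_⟩⟩
  -- The range projection of the isometry is a scalar by irreducibility of the target; compressing
  -- it by the isometry shows that the scalar is `1`.
  obtain ⟨c, hc⟩ := C.scalar_of_irr hρ _ (C.mul_mem _ hρ.1 _ hσ.1 _ hρ.1 _ (he.mem 0 hm) _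
    (C.star_mem _ hσ.1 _ hρ.1 _ (he.mem 0 hm)))
  have h2 : c • (1 : A) = (1 : ℂ) • 1 := by
    calc c • (1 : A) = star (e 0) * (c • (1 : A)) * e 0 := by
          rw [mul_smul_comm, smul_mul_assoc, mul_one, h1]
      _ = star (e 0) * e 0 * (star (e 0) * e 0) := by rw [← hc]; simp only [mul_assoc]
      _ = _ := by rw [h1, one_smul, one_mul]
  rw [hc, h2, one_smul]

theorem not_disjoint_of_unitarilyEquiv (h : UnitarilyEquiv σ ρ) : ¬ DisjointEnd σ ρ := by
  obtain ⟨U, hU, hU'⟩ := h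
  intro h0
  rw [h0] at hU
  rw [(Submodule.mem_bot ℂ).mp hU] at hU'
  simpa using hU'.1

/-- Strong induction on the dimension: a nontrivial projection splits `α` into two objects of
positive, hence strictly smaller, dimension. -/
theorem exists_decomposition (hα : α ∈ T.Ob) :
    ∃ (ι : Type) (_ : Fintype ι) (σ : ι → EndStar A) (W : ι → A), (∀ i, σ i ∈ T.Irr) ∧
      (∀ i, W i ∈ C.hom (σ i) α) ∧ ∑ i, W i * star (W i) = 1 := by
  obtain ⟨n, -, hn⟩ := C.exists_dim_eq_natCast hα
  induction n using Nat.strong_induction_on generalizing α with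
  | _ n ih =>
  by_cases h : ∀ X ∈ C.hom α α, ∃ c : ℂ, X = c • (1 : A)
  · exact ⟨Unit, inferInstance, fun _ => α, fun _ => 1, fun _ => C.irr_of_scalar hα h,
      fun _ => C.one_mem α hα, by simp⟩
  obtain ⟨E, hE, hE1, hE2, hE3⟩ := C.exists_isStarProjection hα h
  obtain ⟨β, hβ, V, hV, hVi, rfl⟩ := C.subobject α hα E hE hE1 hE2
  obtain ⟨γ, hγ, W, hW, hWi, hVW⟩ := C.complement α hα β hβ V hV hVi hE3
  obtain ⟨k, hk, hk'⟩ := C.exists_dim_eq_natCast hβ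
  obtain ⟨l, hl, hl'⟩ := C.exists_dim_eq_natCast hγ
  have hdim : k + l = n := by
    have h1 := C.star_S_mul_S hα
    rw [← mul_one (star (C.S α)), ← hVW, mul_add, add_mul,
      C.star_S_mul_mul_star_mul_S hα hβ hV hVi, C.star_S_mul_mul_star_mul_S hα hγ hW hWi,
      ← add_smul, hVW] at h1
    have := smul_one_injective h1
    rw [hk', hl', hn] at this
    exact_mod_cast this
  obtain ⟨ι, _, σ, X, hσ, hX, hX1⟩ := ih k (by omega) hβ hk'
  obtain ⟨κ, _, τ, Y, hτ, hY, hY1⟩ := ih l (by omega) hγ hl'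
  refine ⟨ι ⊕ κ, inferInstance, Sum.elim σ τ, Sum.elim (V * X ·) (W * Y ·), ?_, ?_, ?_⟩
  · rintro (i | i)
    exacts [hσ i, hτ i]
  · rintro (i | i)
    · exact C.mul_mem _ (hσ i).1 _ hβ _ hα _ hV _ (hX i)
    · exact C.mul_mem _ (hτ i).1 _ hγ _ hα _ hW _ (hY i)
  · have h1 : ∑ i, V * X i * star (V * X i) = V * star V := by
      exact sum_mul_star_conj V X hX1
    have h2 : ∑ i, W * Y i * star (W * Y i) = W * star W := by
      exact sum_mul_star_conj W Y hY1
    rw [Fintype.sum_sum_type, ← hVW, ← h1, ← h2]; rfl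

end SymmetricSubcategory

/-! ### Unitary equivalence as an equivalence relation -/

section UnitaryEquivalence

variable {A : Type*} [CStarAlgebra A] {α β γ : EndStar A}

theorem UnitarilyEquiv.symm (h : UnitarilyEquiv α β) : UnitarilyEquiv β α := by
  obtain ⟨U, hU, h1, h2⟩ := h
  refine ⟨star U, fun a => ?_, Unitary.star_mem ⟨h1, h2⟩⟩
  calc star U * β a = star U * (β a * U) * star U := by
        rw [mul_assoc, mul_assoc, h2, mul_one]
    _ = α a * star U := by rw [← hU a, ← mul_assoc, h1, one_mul]

theorem UnitarilyEquiv.trans (h : UnitarilyEquiv α β) (h' : UnitarilyEquiv β γ) :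
    UnitarilyEquiv α γ := by
  obtain ⟨U, hU, hU'⟩ := h
  obtain ⟨V, hV, hV'⟩ := h'
  refine ⟨V * U, fun a => ?_, mul_mem hV' hU'⟩
  rw [mul_assoc, hU a, ← mul_assoc, hV a, mul_assoc]

theorem UnitarilyEquiv.refl (α : EndStar A) : UnitarilyEquiv α α :=
  ⟨1, fun a => by rw [one_mul, mul_one], one_mem _⟩

/-- Only `v` need be orthonormal. Used twice with the roles of `v` and `w` exchanged, this yields
both unitarity relations for `∑ v w*`. -/
theorem sum_mul_star_mul_sum_mul_star {ι : Type*} [DecidableEq ι]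
    (s : Finset ι) (w v : ι → A)
    (hv : ∀ p ∈ s, ∀ q ∈ s, star (v p) * v q = if p = q then 1 else 0) :
    star (∑ p ∈ s, v p * star (w p)) * ∑ p ∈ s, v p * star (w p) =
      ∑ p ∈ s, w p * star (w p) := by
  rw [star_sum, Finset.sum_mul_sum]
  refine Finset.sum_congr rfl fun p hp => ?_
  have (q : ι) : star (v p * star (w p)) * (v q * star (w q)) =
      w p * (star (v p) * v q) * star (w q) := by
    rw [star_mul, star_star]; simp only [mul_assoc]
  rw [Finset.sum_eq_single_of_mem p hp, this, hv p hp p hp, if_pos rfl, mul_one]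
  intro q hq hqp
  rw [this, hv p hp q hq, if_neg hqp.symm, mul_zero, zero_mul]

end UnitaryEquivalence

/-! ### Complete systems, isotypic decomposition and the multiplicity criterion -/

namespace SymmetricSubcategory

variable {A : Type*} [CStarAlgebra A] {T : EndCategory A} (C : SymmetricSubcategory T)
  {α β ρ σ : EndStar A}

/-- One representative per unitary equivalence class; Schur's lemma makes inequivalent
representatives disjoint. -/
theorem exists_isCompleteIrr [Nontrivial A] (C : SymmetricSubcategory T) :
    ∃ I : Set (EndStar A), T.IsCompleteIrr I := by
  let s : Setoid T.Irr :=
    ⟨fun σ ρ => UnitarilyEquiv σ.1 ρ.1, ⟨fun σ => .refl σ.1, .symm, .trans⟩⟩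
  refine ⟨Set.range fun q : Quotient s => q.out.1, ?_, ?_, ?_⟩
  · rintro _ ⟨q, rfl⟩
    exact q.out.2
  · rintro _ ⟨q, rfl⟩ _ ⟨q', rfl⟩ hne
    by_contra h
    obtain ⟨U, hU, hU'⟩ := C.exists_unitary_of_not_disjoint q.out.2 q'.out.2 h
    apply hne
    have : (⟦q.out⟧ : Quotient s) = ⟦q'.out⟧ :=
      Quotient.sound ⟨U, C.hom_le _ q.out.2.1 _ q'.out.2.1 hU, hU'⟩
    rw [Quotient.out_eq, Quotient.out_eq] at this
    rw [this]
  · intro σ hσ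
    exact ⟨_, ⟨⟦⟨σ, hσ⟩⟧, rfl⟩, (Quotient.mk_out (s := s) ⟨σ, hσ⟩).symm⟩

theorem eq_zero_of_ne {I : Set (EndStar A)} (hI : T.IsCompleteIrr I) (hρ : ρ ∈ I) (hσ : σ ∈ I)
    (hne : ρ ≠ σ) {X : A} (hX : X ∈ C.hom ρ σ) : X = 0 := by
  have h := C.hom_le _ (hI.irr hρ).1 _ (hI.irr hσ).1 hX
  rw [hI.disjoint ρ hρ σ hσ hne] at h
  exact (Submodule.mem_bot ℂ).mp h

/-- Orthonormal bases of the arrows from the members of a complete system are mutually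
orthogonal. -/
theorem star_mul_eq_ite [DecidableEq (EndStar A)] {I : Set (EndStar A)} (hI : T.IsCompleteIrr I)
    (hα : α ∈ T.Ob) {B : EndStar A → ℕ → A} (hB : ∀ ρ ∈ I, C.IsOrthonormalBasis ρ α (B ρ))
    {p q : Σ _ : EndStar A, ℕ} (hp : p.1 ∈ I) (hp' : p.2 < C.mult p.1 α) (hq : q.1 ∈ I)
    (hq' : q.2 < C.mult q.1 α) :
    star (B p.1 p.2) * B q.1 q.2 = if p = q then 1 else 0 := by
  obtain ⟨ρ, i⟩ := p
  obtain ⟨σ, j⟩ := q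
  by_cases h : ρ = σ
  · subst h
    rw [(hB ρ hp).star_mul i hp' j hq']
    simp
  · rw [if_neg fun h' => h (congrArg Sigma.fst h')]
    refine C.eq_zero_of_ne hI hq hp (Ne.symm h) ?_
    exact C.mul_mem _ (hI.irr hq).1 _ hα _ (hI.irr hp).1 _
      (C.star_mem _ (hI.irr hp).1 _ hα _ ((hB _ hp).mem i hp')) _ ((hB _ hq).mem j hq')

/-- The basis of `(ρ, α)_ℂ` also expands the larger space `(ρ, α)`: left multiplication by `∑ e e*`
ignores the right coefficients from `ρ(Z)`. -/
theorem sum_mul_of_mem_intertwiners (hρ : ρ ∈ T.Ob) (hα : α ∈ T.Ob) {e : ℕ → A}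
    (he : C.IsOrthonormalBasis ρ α e) {X : A} (hX : X ∈ intertwiners ρ α) :
    ∑ i ∈ Finset.range (C.mult ρ α), e i * star (e i) * X = X := by
  rw [C.generates _ hρ _ hα] at hX
  refine Submodule.span_induction ?_ ?_ ?_ ?_ hX
  · rintro _ ⟨F, hF, z, -, rfl⟩
    conv_rhs => rw [← he.sum_mul F hF, Finset.sum_mul]
    simp only [mul_assoc]
  · simp
  · intro X Y _ _ hX hY
    simp only [mul_add, Finset.sum_add_distrib, hX, hY]
  · intro c X _ hX
    simp only [mul_smul_comm, ← Finset.smul_sum, hX]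

variable [Nontrivial A]

/-- Every object is the direct sum of finitely many members of a complete system. -/
theorem exists_finset_sum_eq_one {I : Set (EndStar A)} (hI : T.IsCompleteIrr I) (hα : α ∈ T.Ob) :
    ∃ F : Finset (EndStar A), (F : Set (EndStar A)) ⊆ I ∧
      ∀ G : Finset (EndStar A), F ⊆ G → (G : Set (EndStar A)) ⊆ I → ∀ B : EndStar A → ℕ → A,
        (∀ ρ ∈ I, C.IsOrthonormalBasis ρ α (B ρ)) →
        ∑ p ∈ G.sigma fun ρ => Finset.range (C.mult ρ α), B p.1 p.2 * star (B p.1 p.2) = 1 := by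
  classical
  obtain ⟨ι, _, σ, W, hσ, hW, hW1⟩ := C.exists_decomposition hα
  choose τ hτ hστ using fun i => hI.complete (σ i) (hσ i)
  choose U hU hU' using fun i => C.exists_unitary_of_not_disjoint (hσ i) (hI.irr (hτ i))
    (not_disjoint_of_unitarilyEquiv (hστ i))
  refine ⟨Finset.univ.image τ, ?_, fun G hFG hG B hB => ?_⟩
  · intro ρ hρ
    obtain ⟨i, -, rfl⟩ := Finset.mem_image.mp (Finset.mem_coe.mp hρ)
    exact hτ i
  · set P := ∑ p ∈ G.sigma fun ρ => Finset.range (C.mult ρ α), B p.1 p.2 * star (B p.1 p.2)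
    have hV (i : ι) : W i * star (U i) ∈ C.hom (τ i) α :=
      C.mul_mem _ (hI.irr (hτ i)).1 _ (hσ i).1 _ hα _ (hW i) _
        (C.star_mem _ (hσ i).1 _ (hI.irr (hτ i)).1 _ (hU i))
    -- Only the block of `τ i` acts on an arrow out of `τ i`; the other blocks vanish by
    -- disjointness.
    have hP (i : ι) : P * (W i * star (U i)) = W i * star (U i) := by
      rw [Finset.sum_mul, Finset.sum_sigma, Finset.sum_eq_single_of_mem (τ i)
        (hFG (Finset.mem_image_of_mem τ (Finset.mem_univ i)))]
      · exact (hB _ (hτ i)).sum_mul _ (hV i)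
      · intro ρ hρ hne
        refine Finset.sum_eq_zero fun l hl => ?_
        have hρI := hG hρ
        have : star (B ρ l) * (W i * star (U i)) = 0 := by
          refine C.eq_zero_of_ne hI (hτ i) hρI hne.symm ?_
          exact C.mul_mem _ (hI.irr (hτ i)).1 _ hα _ (hI.irr hρI).1 _
            (C.star_mem _ (hI.irr hρI).1 _ hα _ ((hB _ hρI).mem l (Finset.mem_range.mp hl)))
            _ (hV i)
        rw [mul_assoc, this, mul_zero]
    have hP' (i : ι) : P * W i = W i := by
      calc P * W i = P * (W i * star (U i)) * U i := by
            rw [mul_assoc, mul_assoc, (hU' i).1, mul_one]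
        _ = W i := by rw [hP, mul_assoc, (hU' i).1, mul_one]
    rw [← mul_one P, ← hW1, Finset.mul_sum]
    exact Finset.sum_congr rfl fun i _ => by rw [← mul_assoc, hP']

theorem unitarilyEquiv_of_mult_eq {I : Set (EndStar A)} (hI : T.IsCompleteIrr I)
    (hα : α ∈ T.Ob) (hβ : β ∈ T.Ob) (h : ∀ ρ ∈ I, C.mult ρ α = C.mult ρ β) :
    UnitarilyEquiv α β := by
  classical
  obtain ⟨F, hF, hF'⟩ := C.exists_finset_sum_eq_one hI hα
  obtain ⟨G, hG, hG'⟩ := C.exists_finset_sum_eq_one hI hβ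
  have hex (γ : EndStar A) (hγ : γ ∈ T.Ob) : ∃ B : EndStar A → ℕ → A,
      ∀ ρ ∈ I, C.IsOrthonormalBasis ρ γ (B ρ) := by
    choose! B hB using fun ρ (hρ : ρ ∈ I) => (C.exists_isOrthonormalBasis (hI.irr hρ) hγ).2
    exact ⟨B, hB⟩
  obtain ⟨W, hW⟩ := hex α hα
  obtain ⟨V, hV⟩ := hex β hβ
  -- Enlarging both supports to their union gives the two resolutions of `1` a common index set.
  have hFG : ((F ∪ G : Finset (EndStar A)) : Set (EndStar A)) ⊆ I := by
    rw [Finset.coe_union]; exact Set.union_subset hF hG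
  have h1 := hF' _ Finset.subset_union_left hFG W hW
  have h2 := hG' _ Finset.subset_union_right hFG V hV
  have hs : (F ∪ G).sigma (fun ρ => Finset.range (C.mult ρ β)) =
      (F ∪ G).sigma (fun ρ => Finset.range (C.mult ρ α)) :=
    Finset.ext fun p => by
      rw [Finset.mem_sigma, Finset.mem_sigma]
      exact and_congr_right fun hp => by rw [h _ (hFG hp)]
  rw [hs] at h2
  set s := (F ∪ G).sigma (fun ρ => Finset.range (C.mult ρ α))
  have hmem : ∀ p ∈ s, p.1 ∈ I ∧ p.2 < C.mult p.1 α ∧ p.2 < C.mult p.1 β := fun p hp => by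
    obtain ⟨hp1, hp2⟩ := Finset.mem_sigma.mp hp
    have := Finset.mem_range.mp hp2
    exact ⟨hFG hp1, this, h _ (hFG hp1) ▸ this⟩
  refine ⟨∑ p ∈ s, V p.1 p.2 * star (W p.1 p.2), ?_, ?_, ?_⟩
  · refine Submodule.sum_mem _ fun p hp => C.hom_le _ hα _ hβ ?_
    obtain ⟨h3, h4, h5⟩ := hmem p hp
    exact C.mul_mem _ hα _ (hI.irr h3).1 _ hβ _ ((hV _ h3).mem _ h5) _
      (C.star_mem _ (hI.irr h3).1 _ hα _ ((hW _ h3).mem _ h4))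
  · rw [sum_mul_star_mul_sum_mul_star s (fun p => W p.1 p.2) (fun p => V p.1 p.2), h1]
    exact fun p hp q hq => C.star_mul_eq_ite hI hβ hV (hmem p hp).1 (hmem p hp).2.2
      (hmem q hq).1 (hmem q hq).2.2
  · have := sum_mul_star_mul_sum_mul_star s (fun p => V p.1 p.2) (fun p => W p.1 p.2)
      fun p hp q hq => C.star_mul_eq_ite hI hα hW (hmem p hp).1 (hmem p hp).2.1
        (hmem q hq).1 (hmem q hq).2.1
    rw [h2] at this
    simpa [star_sum] using this

/-- Multiplicities are invariant under unitary equivalence in `T`: the matrix of a unitary with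
respect to orthonormal bases is an invertible matrix over the center. -/
theorem mult_eq_of_unitarilyEquiv (hρ : ρ ∈ T.Irr) (hα : α ∈ T.Ob) (hβ : β ∈ T.Ob)
    (h : UnitarilyEquiv α β) : C.mult ρ α = C.mult ρ β := by
  obtain ⟨U, hU, hU1, hU2⟩ := h
  have hU' : star U ∈ intertwiners β α := fun a => by
    simpa [← map_star] using (congrArg star (hU (star a))).symm
  obtain ⟨-, e, he⟩ := C.exists_isOrthonormalBasis hρ hα
  obtain ⟨-, f, hf⟩ := C.exists_isOrthonormalBasis hρ hβ
  -- Matrix entries lie in `(ρ, ρ)`, which is the center by irreducibility.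
  have hentry {γ δ : EndStar A} (hγ : γ ∈ T.Ob) (hδ : δ ∈ T.Ob) {X u Y : A} (hX : X ∈ C.hom ρ γ)
      (hu : u ∈ intertwiners δ γ) (hY : Y ∈ C.hom ρ δ) :
      star X * (u * Y) ∈ Subalgebra.center ℂ A := by
    have : star X * (u * Y) ∈ (intertwiners ρ ρ : Set A) := fun a => by
      rw [mul_assoc, mul_assoc, C.intertwine hρ.1 hδ hY, ← mul_assoc u, hu a, mul_assoc,
        ← mul_assoc, C.intertwine hγ hρ.1 (C.star_mem _ hρ.1 _ hγ _ hX), mul_assoc]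
    rw [hρ.2] at this
    exact this
  let M : Matrix (Fin (C.mult ρ β)) (Fin (C.mult ρ α)) (Subalgebra.center ℂ A) := fun k i =>
    ⟨_, hentry hβ hα (hf.mem k k.2) hU (he.mem i i.2)⟩
  let N : Matrix (Fin (C.mult ρ α)) (Fin (C.mult ρ β)) (Subalgebra.center ℂ A) := fun i k =>
    ⟨_, hentry hα hβ (he.mem i i.2) hU' (hf.mem k k.2)⟩
  have hmul {γ δ : EndStar A} (hγ : γ ∈ T.Ob) (hδ : δ ∈ T.Ob) {g k : ℕ → A}
      (hg : C.IsOrthonormalBasis ρ γ g) (hk : C.IsOrthonormalBasis ρ δ k) {u : A}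
      (hu : star u ∈ intertwiners γ δ) (huu : u * star u = 1) (i j : Fin (C.mult ρ γ)) :
      ∑ l : Fin (C.mult ρ δ), star (g i) * (u * k l) * (star (k l) * (star u * g j)) =
        if i = j then 1 else 0 := by
    -- This arrow belongs to `T` but perhaps not to `T_ℂ`, so the expansion over the larger
    -- intertwiner space is needed.
    have hX : star u * g j ∈ intertwiners ρ δ := fun a => by
      rw [mul_assoc, C.intertwine hρ.1 hγ (hg.mem j j.2), ← mul_assoc, hu a, mul_assoc]
    have h1 := C.sum_mul_of_mem_intertwiners hρ.1 hδ hk hX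
    rw [Finset.sum_range] at h1
    calc _ = star (g i) * (u * ∑ l : Fin (C.mult ρ δ), k l * star (k l) * (star u * g j)) := by
          rw [Finset.mul_sum, Finset.mul_sum]
          exact Finset.sum_congr rfl fun l _ => by simp only [mul_assoc]
      _ = star (g i) * (u * star u) * g j := by rw [h1]; simp only [mul_assoc]
      _ = _ := by
          rw [huu, mul_one, hg.star_mul i i.2 j j.2]
          simp only [Fin.ext_iff]
  have hMN : M * N = 1 := by
    ext i j
    have := hmul hβ hα hf he hU' hU2 i j
    rw [Matrix.mul_apply, Matrix.one_apply]
    push_cast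
    rw [this]
    split_ifs <;> rfl
  have hNM : N * M = 1 := by
    ext i j
    have := hmul hα hβ he hf (u := star U) (by rwa [star_star]) (by rwa [star_star]) i j
    simp only [star_star] at this
    rw [Matrix.mul_apply, Matrix.one_apply]
    push_cast
    rw [this]
    split_ifs <;> rfl
  simpa using Matrix.square_of_invertible N M hNM hMN

theorem exists_isotypic_decomposition {I : Set (EndStar A)} (hI : T.IsCompleteIrr I)
    (hα : α ∈ T.Ob) :
    ∃ (r : ℕ) (ρ : Fin r → EndStar A) (W : (Σ j : Fin r, Fin (C.mult (ρ j) α)) → A),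
      Function.Injective ρ ∧ (∀ j, ρ j ∈ I) ∧ (∀ j, 0 < C.mult (ρ j) α) ∧
      (∀ p, W p ∈ C.hom (ρ p.1) α) ∧ (∀ p, IsIsom (W p)) ∧
      (∀ p q, p ≠ q → star (W p) * W q = 0) ∧
      ∑ p, W p * star (W p) = 1 ∧
      (∀ a : A, α a = ∑ p, W p * ρ p.1 a * star (W p)) ∧
      C.dim α = ∑ j, (C.mult (ρ j) α : ℂ) * C.dim (ρ j) := by
  classical
  obtain ⟨F, hF, hF'⟩ := C.exists_finset_sum_eq_one hI hα
  choose! B hB using fun ρ (hρ : ρ ∈ I) => (C.exists_isOrthonormalBasis (hI.irr hρ) hα).2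
  have h1 := hF' F subset_rfl hF B hB
  -- Members of multiplicity zero contribute empty sums, so discarding them leaves the resolution of
  -- `1` intact.
  set G := F.filter fun ρ => 0 < C.mult ρ α
  let ρ : Fin G.card → EndStar A := fun j => (G.equivFin.symm j).1
  have hρG (j) : ρ j ∈ G := (G.equivFin.symm j).2
  have hρI (j) : ρ j ∈ I := hF (Finset.mem_filter.mp (hρG j)).1
  have hinj : Function.Injective ρ := Subtype.val_injective.comp G.equivFin.symm.injective
  let W : (Σ j : Fin G.card, Fin (C.mult (ρ j) α)) → A := fun p => B (ρ p.1) p.2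
  have hW (p) : W p ∈ C.hom (ρ p.1) α := (hB _ (hρI p.1)).mem _ p.2.2
  have hWi (p) : IsIsom (W p) := by
    simpa [IsIsom, W] using (hB _ (hρI p.1)).star_mul _ p.2.2 _ p.2.2
  have hW1 : ∑ p, W p * star (W p) = 1 := by
    rw [← h1, Finset.sum_sigma, ← Finset.sum_filter_of_ne (p := fun ρ => 0 < C.mult ρ α),
      Fintype.sum_sigma]
    · refine (Fintype.sum_congr _ _ fun j => (Finset.sum_range _).symm).trans
        ((Equiv.sum_comp G.equivFin.symm fun σ => ∑ l ∈ Finset.range (C.mult σ.1 α),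
          B σ.1 l * star (B σ.1 l)).trans (Finset.sum_coe_sort G fun σ =>
            ∑ l ∈ Finset.range (C.mult σ α), B σ l * star (B σ l)))
    · intro σ _ hne
      by_contra! h0
      rw [Nat.le_zero.mp h0, Finset.range_zero, Finset.sum_empty] at hne
      exact hne rfl
  refine ⟨G.card, ρ, W, hinj, hρI, fun j => (Finset.mem_filter.mp (hρG j)).2, hW, hWi, ?_, hW1,
    fun a => ?_, ?_⟩
  · rintro ⟨j, l⟩ ⟨j', l'⟩ hne
    refine (C.star_mul_eq_ite hI hα hB (p := ⟨ρ j, l⟩) (q := ⟨ρ j', l'⟩) (hρI j) l.2 (hρI j')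
      l'.2).trans (if_neg fun h => hne ?_)
    obtain ⟨h2, h3⟩ := Sigma.mk.inj_iff.mp h
    obtain rfl := hinj h2
    rw [Fin.ext (eq_of_heq h3)]
  · conv_lhs => rw [← mul_one (α a), ← hW1, Finset.mul_sum]
    exact Finset.sum_congr rfl fun p _ => by
      rw [← mul_assoc, ← C.intertwine (hI.irr (hρI p.1)).1 hα (hW p)]
  · rw [C.dim_eq_sum hα Finset.univ (fun p => ρ p.1) W (fun p _ => (hI.irr (hρI p.1)).1)
      (fun p _ => hW p) (fun p _ => hWi p) hW1, Fintype.sum_sigma]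
    simp

end SymmetricSubcategory

theorem proposition3p5 {A : Type*} [CStarAlgebra A] [Nontrivial A]
    (T : EndCategory A) (C : SymmetricSubcategory T) :
    -- (I) dimensions are natural numbers
    (∀ α ∈ T.Ob, ∃ n : ℕ, 0 < n ∧ C.dim α = n) ∧
    -- the multiplicities are finite and complete systems of irreducibles exist
    (∀ ρ ∈ T.Irr, ∀ α ∈ T.Ob, FiniteDimensional ℂ (C.hom ρ α)) ∧
    (∃ I : Set (EndStar A), T.IsCompleteIrr I) ∧
    -- (II) decomposition into irreducibles
    (∀ I : Set (EndStar A), T.IsCompleteIrr I → ∀ α ∈ T.Ob,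
      ∃ (r : ℕ) (ρ : Fin r → EndStar A) (W : (Σ j : Fin r, Fin (C.mult (ρ j) α)) → A),
        Function.Injective ρ ∧ (∀ j, ρ j ∈ I) ∧ (∀ j, 0 < C.mult (ρ j) α) ∧
        (∀ p, W p ∈ C.hom (ρ p.1) α) ∧ (∀ p, IsIsom (W p)) ∧
        (∀ p q, p ≠ q → star (W p) * W q = 0) ∧
        ∑ p, W p * star (W p) = 1 ∧
        (∀ a : A, α a = ∑ p, W p * ρ p.1 a * star (W p)) ∧
        C.dim α = ∑ j, (C.mult (ρ j) α : ℂ) * C.dim (ρ j)) ∧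
    -- (III) unitary equivalence is detected by the multiplicities
    (∀ α ∈ T.Ob, ∀ β ∈ T.Ob,
      (UnitarilyEquiv α β ↔ ∀ ρ ∈ T.Irr, C.mult ρ α = C.mult ρ β) ∧
      ∀ I : Set (EndStar A), T.IsCompleteIrr I →
        (UnitarilyEquiv α β ↔ ∀ ρ ∈ I, C.mult ρ α = C.mult ρ β)) := by
  refine ⟨fun α hα => C.exists_dim_eq_natCast hα,
    fun ρ hρ α hα => (C.exists_isOrthonormalBasis hρ hα).1, C.exists_isCompleteIrr,
    fun I hI α hα => C.exists_isotypic_decomposition hI hα, fun α hα β hβ => ⟨⟨?_, ?_⟩, ?_⟩⟩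
  · exact fun h ρ hρ => C.mult_eq_of_unitarilyEquiv hρ hα hβ h
  · intro h
    obtain ⟨I, hI⟩ := C.exists_isCompleteIrr
    exact C.unitarilyEquiv_of_mult_eq hI hα hβ fun ρ hρ => h ρ (hI.irr hρ)
  · exact fun I hI => ⟨fun h ρ hρ => C.mult_eq_of_unitarilyEquiv (hI.irr hρ) hα hβ h,
      C.unitarilyEquiv_of_mult_eq hI hα hβ⟩
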